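/- Let $n\ge 0$, let $\|\cdot\|$ be the Euclidean norm on $\mathbb R^n$, and let all random variables be $\mathbb R^n$-valued on one probability space. Notation. For a proper lower semicontinuous convex function $\psi:\mathbb R^n\to(-\infty,\infty]$, $\operatorname{prox}_\psi(z_0)=\operatorname{argmin}_{z\in\mathbb R^n}\{\psi(z)+\tfrac12\|z-z_0\|^2\}$. For probability measures $\mu,\nu$ on $\mathbb R^n$, $$\mathcal W_\infty(\mu,\nu)=\inf_{\pi\in\Gamma(\mu,\nu)}\operatorname*{ess\,sup}_{(x,y)\sim\pi}\|x-y\|,$$ where $\Gamma(\mu,\nu)$ is the set of measures on $\mathbb R^n\times\mathbb R^n$ with marginals $\mu$ and $\nu$. For $\alpha\in(1,\infty)$, $$D_\alpha(\mu\|\nu)=\frac1{\alpha-1}\log\int\Big(\frac{d\mu}{d\nu}\Big)^{\alpha}d\nu\ \text{ if }\mu\ll\nu,\qquad D_\alpha(\mu\|\nu)=\infty\ \text{ otherwise,}$$ and for $\tau\ge0$ the shifted divergence is $$D_\alpha^{(\tau)}(\mu\|\nu)=\inf\{D_\alpha(\gamma\|\nu):\ \gamma\text{ a probability measure on }\mathbb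 R^n,\ \mathcal W_\infty(\mu,\gamma)\le\tau\}\in[0,\infty].$$ For random variables, $D_\alpha^{(\tau)}(X\|X')$ is the shifted divergence of their laws. Lemma. Let $L,\zeta\ge0$ and $s\in\mathbb R$, and let $\phi,\phi'$ be $\mathbb R^n$-valued measurable maps with domains $\operatorname{dom}\phi,\operatorname{dom}\phi'\subseteq\mathbb R^n$ such that, for all $u,x,y\in\operatorname{dom}\phi\cap\operatorname{dom}\phi'$, $$\|\phi'(u)-\phi(u)\|\le s,\qquad \|\Phi(x)-\Phi(y)\|\le L\|x-y\|+\zeta\quad\text{for each }\Phi\in\{\phi,\phi'\}.$$ Let $Y,Y'$ be random variables with values almost surely in $\operatorname{dom}\phi\cap\operatorname{dom}\phi'$, let $\sigma>0$, let $Z\sim\mathcal N(0,\sigma^2I)$ be independent of $Y$ and independent of $Y'$, and let $\psi:\mathbb R^n\to(-\infty,\infty]$ be proper, lower semicontinuous and convex. Then, for all $a,\tau\ge0$ and $\alpha\in(1,\infty)$ with $L\tau+\zeta+s-a\ge0$, $$D_\alpha^{(L\tau+\zeta+s-a)}\big(\operatorname{prox}_\psi(\phi(Y)+Z)\,\big\|\,\operatorname{prox}_\psi(\phi'(Y')+Z)\big)\le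 D_\alpha^{(\tau)}(Y\|Y')+\frac{\alpha a^2}{2\sigma^2}.$$ -/

import Mathlib

open MeasureTheory ProbabilityTheory
open scoped ENNReal

/-- `ψ : E → (-∞, ∞]` is proper, lower semicontinuous and convex. -/
structure IsProperLscConvex {E : Type*} [AddCommGroup E] [Module ℝ E] [TopologicalSpace E]
    (ψ : E → EReal) : Prop where
  ne_bot : ∀ x, ψ x ≠ ⊥
  proper : ∃ x, ψ x ≠ ⊤
  lsc : LowerSemicontinuous ψ
  convex : ∀ x y : E, ∀ a b : ℝ, 0 ≤ a → 0 ≤ b → a + b = 1 →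
    ψ (a • x + b • y) ≤ (a : EReal) * ψ x + (b : EReal) * ψ y

/-- The objective `z ↦ ψ(z) + ‖z - z₀‖² / 2` of the proximal problem. -/
noncomputable def proxObjective {E : Type*} [NormedAddCommGroup E]
    (ψ : E → EReal) (z₀ z : E) : EReal :=
  ψ z + ((‖z - z₀‖ ^ 2 / 2 : ℝ) : EReal)

/-- The proximal operator: `prox ψ z₀` is a minimizer of `z ↦ ψ(z) + ‖z - z₀‖² / 2` (the minimizer
exists and is unique for `ψ` proper, lower semicontinuous and convex on a Euclidean space). -/
noncomputable def prox {E : Type*} [NormedAddCommGroup E] (ψ : E → EReal) (z₀ : E) : E :=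
  Classical.epsilon fun p => ∀ z, proxObjective ψ z₀ p ≤ proxObjective ψ z₀ z

/-- `π` is a coupling of `μ` and `ν`: its first and second marginals are `μ` and `ν`. -/
def IsCouplingOf {E : Type*} [MeasurableSpace E] (π : Measure (E × E)) (μ ν : Measure E) : Prop :=
  π.map Prod.fst = μ ∧ π.map Prod.snd = ν

/-- The `∞`-Wasserstein distance
`W_∞(μ, ν) = inf_{π ∈ Γ(μ, ν)} ess sup_{(x, y) ∼ π} ‖x - y‖`, valued in `[0, ∞]`. -/
noncomputable def wassersteinInfty {E : Type*} [NormedAddCommGroup E] [MeasurableSpace E]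
    (μ ν : Measure E) : ℝ≥0∞ :=
  ⨅ (π : Measure (E × E)) (_ : IsCouplingOf π μ ν), essSup (fun p : E × E => ‖p.1 - p.2‖ₑ) π

open Classical in
/-- The Rényi divergence of order `α ∈ (1, ∞)`:
`D_α(μ‖ν) = (α - 1)⁻¹ log ∫ (dμ/dν)^α dν` if `μ ≪ ν`, and `∞` otherwise. -/
noncomputable def renyiDiv {E : Type*} [MeasurableSpace E] (α : ℝ) (μ ν : Measure E) : EReal :=
  if μ ≪ ν then (((α - 1)⁻¹ : ℝ) : EReal) * ENNReal.log (∫⁻ x, (μ.rnDeriv ν x) ^ α ∂ν) else ⊤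

/-- The shifted Rényi divergence
`D_α^{(τ)}(μ‖ν) = inf {D_α(γ‖ν) : γ a probability measure with W_∞(μ, γ) ≤ τ}`, for `τ ≥ 0`. -/
noncomputable def shiftedRenyiDiv {E : Type*} [NormedAddCommGroup E] [MeasurableSpace E]
    (α τ : ℝ) (μ ν : Measure E) : EReal :=
  ⨅ (γ : Measure E) (_ : IsProbabilityMeasure γ)
    (_ : wassersteinInfty μ γ ≤ ENNReal.ofReal τ), renyiDiv α γ ν

/-! Fix `γ` with `W_∞(Y, γ) ≤ τ` and `γ ≪ ν`, where `ν` is the law of `Y'`, and a nearly optimal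
coupling `(x, y)` of the law of `Y` and `γ`. Comparing first `φ x` with `φ y`, then `φ y` with `φ'
y`, bounds `d = φ x - φ' y` by `R = Lτ + ζ + s`, up to the slack in the coupling. Split `d` into `v
= (a / R) d`, of norm at most `a`, and a remainder of norm at most `R - a`. Since `prox` is
nonexpansive, the law of `prox (φ' y + v + z)` lies within `R - a` of that of `prox (φ x + z)`, so
it is admissible in the shifted divergence on the left.

Its Rényi divergence from the law of `prox (φ' Y' + Z)` is at most that between joint laws of
(coupled pair, noise), by data processing. There the translation `v` is charged to the noise: the
joint density is `dγ/dν (y)` times a Cameron–Martin density, and integrating its `α`-th power over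
the noise costs at most `exp (α (α - 1) a² / (2σ²))`. This is
`shiftedRenyiDiv_map_prod_multivariateGaussian_le`, resting on `lipschitzWith_prox`,
`lintegral_rnDeriv_map_rpow_le` and `lintegral_mul_gaussianShiftDensity_rpow_le`. -/

/-! ### Existence and nonexpansiveness of the proximal map -/

section Prox

variable {E : Type*}

lemma IsProperLscConvex.lowerSemicontinuous_proxObjective [NormedAddCommGroup E]
    [Module ℝ E] {ψ : E → EReal} (hψ : IsProperLscConvex ψ) (x : E) :
    LowerSemicontinuous (proxObjective ψ x) := by
  have hc : Continuous fun z : E => ((‖z - x‖ ^ 2 / 2 : ℝ) : EReal) :=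
    continuous_coe_real_ereal.comp (by fun_prop)
  exact hψ.lsc.add' hc.lowerSemicontinuous fun z =>
    EReal.continuousAt_add (Or.inr (EReal.coe_ne_bot _)) (Or.inr (EReal.coe_ne_top _))

/-- A proper lower semicontinuous convex function decreases at most linearly. -/
lemma IsProperLscConvex.exists_linear_minorant [NormedAddCommGroup E] [NormedSpace ℝ E]
    [ProperSpace E] {ψ : E → EReal} (hψ : IsProperLscConvex ψ) {x₀ : E} {A : ℝ}
    (hA : ψ x₀ = (A : EReal)) :
    ∃ c : ℝ, ∀ z, 1 ≤ ‖z - x₀‖ → ((A - c * ‖z - x₀‖ : ℝ) : EReal) ≤ ψ z := by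
  obtain ⟨w, -, hw⟩ := (hψ.lsc.lowerSemicontinuousOn (s := Metric.closedBall x₀ 1)).exists_isMinOn
    ⟨x₀, Metric.mem_closedBall_self zero_le_one⟩ (isCompact_closedBall x₀ 1)
  have hwA : ψ w ≤ A := hA ▸ hw (Metric.mem_closedBall_self zero_le_one)
  lift ψ w to ℝ using ⟨ne_top_of_le_ne_top (EReal.coe_ne_top _) hwA, hψ.ne_bot w⟩ with m hm
  -- `m` is the minimum of `ψ` on the unit ball; the segment from `x₀` to `z` leaves that ball at a
  -- point with value at least `m`, and convexity extrapolates this to `z`.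
  refine ⟨A - m, fun z hz => ?_⟩
  by_cases hzt : ψ z = ⊤
  · rw [hzt]; exact le_top
  lift ψ z to ℝ using ⟨hzt, hψ.ne_bot z⟩ with B hB
  set r := ‖z - x₀‖
  have hr : 0 < r := by linarith
  have hr1 : r⁻¹ ≤ 1 := inv_le_one_of_one_le₀ hz
  have hmem : (1 - r⁻¹) • x₀ + r⁻¹ • z ∈ Metric.closedBall x₀ 1 := by
    rw [mem_closedBall_iff_norm]
    have : (1 - r⁻¹) • x₀ + r⁻¹ • z - x₀ = r⁻¹ • (z - x₀) := by module
    rw [this, norm_smul, Real.norm_of_nonneg (by positivity), inv_mul_cancel₀ hr.ne']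
  have h1 := (hw hmem).trans (hψ.convex x₀ z (1 - r⁻¹) r⁻¹ (by linarith) (by positivity) (by ring))
  rw [← hm, hA, ← hB] at h1
  norm_cast at h1 ⊢
  have h2 : r * m ≤ r * ((1 - r⁻¹) * A + r⁻¹ * B) := by gcongr
  have h3 : r * ((1 - r⁻¹) * A + r⁻¹ * B) = r * A - A + B := by field_simp
  linarith

/-- The quadratic term beats the linear minorant outside a large ball, so minimizing over a compact
ball suffices. -/
lemma IsProperLscConvex.exists_prox [NormedAddCommGroup E] [NormedSpace ℝ E]
    [ProperSpace E] {ψ : E → EReal} (hψ : IsProperLscConvex ψ) (x : E) :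
    ∃ p, ∀ z, proxObjective ψ x p ≤ proxObjective ψ x z := by
  obtain ⟨x₀, hx₀⟩ := hψ.proper
  obtain ⟨A, hA⟩ : ∃ A : ℝ, ψ x₀ = A := ⟨_, (EReal.coe_toReal hx₀ (hψ.ne_bot x₀)).symm⟩
  obtain ⟨c, hc⟩ := hψ.exists_linear_minorant hA
  set d := ‖x₀ - x‖ with hd
  -- For `t = ‖z - x₀‖`, beating the value at `x₀` requires `c t + d t ≤ t² / 2`, which `t ≥ 2|c| +
  -- 2d` ensures; the `1` makes the minorant applicable.
  set R : ℝ := 1 + 2 * |c| + 2 * d with hR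
  have hd0 : 0 ≤ d := norm_nonneg _
  have hc0 := abs_nonneg c
  have hR1 : 1 ≤ R := by linarith
  obtain ⟨p, -, hp⟩ :=
    ((hψ.lowerSemicontinuous_proxObjective x).lowerSemicontinuousOn
      (s := Metric.closedBall x₀ R)).exists_isMinOn
      ⟨x₀, Metric.mem_closedBall_self (by linarith)⟩ (isCompact_closedBall x₀ R)
  refine ⟨p, fun z => ?_⟩
  by_cases hz : z ∈ Metric.closedBall x₀ R
  · exact hp hz
  refine (hp (Metric.mem_closedBall_self (by linarith))).trans ?_
  have hzR : R < ‖z - x₀‖ := by simpa [dist_eq_norm] using hz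
  have hzd : ‖z - x₀‖ - d ≤ ‖z - x‖ := by
    have := norm_sub_le_norm_sub_add_norm_sub z x x₀
    rw [norm_sub_rev x x₀] at this
    linarith
  have h1 := hc z (by linarith)
  refine le_trans ?_ (add_le_add_left h1 _)
  show ψ x₀ + _ ≤ _
  rw [hA]
  norm_cast
  rw [← hd]
  have h2 : (‖z - x₀‖ - d) ^ 2 ≤ ‖z - x‖ ^ 2 := pow_le_pow_left₀ (by linarith) hzd 2
  have h3 : c * ‖z - x₀‖ ≤ |c| * ‖z - x₀‖ := by gcongr; exact le_abs_self c
  nlinarith [mul_nonneg (by linarith : 0 ≤ ‖z - x₀‖ - R) (by linarith : 0 ≤ ‖z - x₀‖)]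

lemma IsProperLscConvex.proxObjective_prox_le [NormedAddCommGroup E] [NormedSpace ℝ E]
    [ProperSpace E] {ψ : E → EReal} (hψ : IsProperLscConvex ψ) (x z : E) :
    proxObjective ψ x (prox ψ x) ≤ proxObjective ψ x z :=
  Classical.epsilon_spec (hψ.exists_prox x) z

lemma IsProperLscConvex.prox_ne_top [NormedAddCommGroup E] [NormedSpace ℝ E]
    [ProperSpace E] {ψ : E → EReal} (hψ : IsProperLscConvex ψ) (x : E) :
    ψ (prox ψ x) ≠ ⊤ := by
  obtain ⟨x₀, hx₀⟩ := hψ.proper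
  intro h
  have h1 := hψ.proxObjective_prox_le x x₀
  lift ψ x₀ to ℝ using ⟨hx₀, hψ.ne_bot x₀⟩ with A hA
  rw [proxObjective, proxObjective, h, ← hA, EReal.top_add_coe, ← EReal.coe_add] at h1
  exact EReal.coe_ne_top _ (top_le_iff.1 h1)

lemma nonneg_of_forall_small_add_mul {u w : ℝ} (h : ∀ t, 0 < t → t ≤ 1 → 0 ≤ u + t * w) :
    0 ≤ u := by
  have ht : Filter.Tendsto (fun t : ℝ => u + t * w) (nhdsWithin 0 (Set.Ioi 0)) (nhds u) := by
    have : Continuous fun t : ℝ => u + t * w := by fun_prop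
    simpa using (this.tendsto 0).mono_left nhdsWithin_le_nhds
  refine ge_of_tendsto ht ?_
  filter_upwards [Ioc_mem_nhdsGT (zero_lt_one' ℝ)] with t ht
  exact h t ht.1 ht.2

/-- The variational inequality characterising the proximal point. -/
lemma IsProperLscConvex.add_inner_le [NormedAddCommGroup E] [InnerProductSpace ℝ E]
    [ProperSpace E] {ψ : E → EReal} (hψ : IsProperLscConvex ψ) (x z : E) :
    ψ (prox ψ x) + ((inner ℝ (x - prox ψ x) (z - prox ψ x) : ℝ) : EReal) ≤ ψ z := by
  by_cases hzt : ψ z = ⊤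
  · rw [hzt]; exact le_top
  have hmin := hψ.proxObjective_prox_le x
  have hpt := hψ.prox_ne_top x
  set p := prox ψ x
  obtain ⟨A, hA⟩ : ∃ A : ℝ, ψ p = A := ⟨_, (EReal.coe_toReal hpt (hψ.ne_bot p)).symm⟩
  obtain ⟨B, hB⟩ : ∃ B : ℝ, ψ z = B := ⟨_, (EReal.coe_toReal hzt (hψ.ne_bot z)).symm⟩
  have key : 0 ≤ B - A - inner ℝ (x - p) (z - p) := by
    -- Compare `p` with points of the segment towards `z` and divide by `t`; the quadratic term is
    -- left with a factor `t` and disappears as `t → 0`.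
    refine nonneg_of_forall_small_add_mul (w := ‖z - p‖ ^ 2 / 2) fun t ht0 ht1 => ?_
    have h1 : proxObjective ψ x p ≤ _ := (hmin ((1 - t) • p + t • z)).trans
      (add_le_add_left (hψ.convex p z (1 - t) t (by linarith) ht0.le (by ring)) _)
    rw [proxObjective, hA, hB] at h1
    norm_cast at h1
    have h2 : (1 - t) • p + t • z - x = t • (z - p) - (x - p) := by module
    rw [h2, norm_sub_rev p x, norm_sub_sq_real (t • (z - p)), real_inner_smul_left, norm_smul, Real.norm_of_nonneg ht0.le, mul_pow,
      real_inner_comm] at h1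
    have h4 : 0 ≤ t * (B - A - inner ℝ (x - p) (z - p) + t * (‖z - p‖ ^ 2 / 2)) := by linarith
    exact nonneg_of_mul_nonneg_right h4 ht0
  rw [hA, hB]
  norm_cast
  linarith

/-- Adding the variational inequalities at the two proximal points cancels `ψ` and leaves `‖p - q‖²
≤ ⟪x - y, p - q⟫`; Cauchy–Schwarz concludes. -/
lemma IsProperLscConvex.lipschitzWith_prox [NormedAddCommGroup E] [InnerProductSpace ℝ E]
    [ProperSpace E] {ψ : E → EReal} (hψ : IsProperLscConvex ψ) :
    LipschitzWith 1 (prox ψ) := by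
  refine LipschitzWith.of_dist_le_mul fun x y => ?_
  have h1 := hψ.add_inner_le x (prox ψ y)
  have h2 := hψ.add_inner_le y (prox ψ x)
  have hp := hψ.prox_ne_top x
  have hq := hψ.prox_ne_top y
  set p := prox ψ x
  set q := prox ψ y
  obtain ⟨A, hA⟩ : ∃ A : ℝ, ψ p = A := ⟨_, (EReal.coe_toReal hp (hψ.ne_bot p)).symm⟩
  obtain ⟨B, hB⟩ : ∃ B : ℝ, ψ q = B := ⟨_, (EReal.coe_toReal hq (hψ.ne_bot q)).symm⟩
  rw [hA, hB] at h1 h2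
  norm_cast at h1 h2
  have h3 : inner ℝ (x - p) (q - p) + inner ℝ (y - q) (p - q) =
      ‖p - q‖ ^ 2 - inner ℝ (x - y) (p - q) := by
    rw [← neg_sub p q, inner_neg_right, ← real_inner_self_eq_norm_sq, neg_add_eq_sub,
      ← inner_sub_left, ← inner_sub_left]
    congr 1
    abel
  have h4 : ‖p - q‖ ^ 2 ≤ ‖x - y‖ * ‖p - q‖ := by
    linarith [real_inner_le_norm (x - y) (p - q)]
  rw [dist_eq_norm, dist_eq_norm, NNReal.coe_one, one_mul]
  by_contra! hlt
  nlinarith [norm_nonneg (x - y)]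

end Prox

/-! ### Cameron–Martin densities of translated Gaussians -/

lemma lintegral_pi_prod {ι : Type*} [Fintype ι] {X : ι → Type*} [∀ i, MeasurableSpace (X i)]
    (μ : ∀ i, Measure (X i)) [∀ i, IsProbabilityMeasure (μ i)]
    (f : ∀ i, X i → ℝ≥0∞) (hf : ∀ i, Measurable (f i)) :
    ∫⁻ x, ∏ i, f i (x i) ∂Measure.pi μ = ∏ i, ∫⁻ x, f i x ∂μ i := by
  have h := iIndepFun_pi (μ := μ) (X := f) (fun i => (hf i).aemeasurable)
  rw [lintegral_prod_eq_prod_lintegral_of_indepFun Finset.univ _ h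
    (fun i => (hf i).comp (measurable_pi_apply i))]
  refine Finset.prod_congr rfl fun i _ => ?_
  exact (measurePreserving_eval μ i).lintegral_comp (hf i)

lemma pi_withDensity_eq {ι : Type*} [Fintype ι] {X : ι → Type*} [∀ i, MeasurableSpace (X i)]
    (μ : ∀ i, Measure (X i)) [∀ i, IsProbabilityMeasure (μ i)]
    (f : ∀ i, X i → ℝ≥0∞) (hf : ∀ i, Measurable (f i))
    [∀ i, SigmaFinite ((μ i).withDensity (f i))] :
    Measure.pi (fun i => (μ i).withDensity (f i)) =
      (Measure.pi μ).withDensity (fun x => ∏ i, f i (x i)) := by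
  refine (Measure.pi_eq fun s hs => ?_)
  have hind : ∀ i, Measurable ((s i).indicator (f i)) := fun i => (hf i).indicator (hs i)
  rw [withDensity_apply _ (MeasurableSet.univ_pi hs),
    ← lintegral_indicator (MeasurableSet.univ_pi hs)]
  have : (Set.univ.pi s).indicator (fun x => ∏ i, f i (x i)) =
      fun x => ∏ i, (s i).indicator (f i) (x i) := by
    ext x
    by_cases hx : x ∈ Set.univ.pi s
    · rw [Set.indicator_of_mem hx]
      exact Finset.prod_congr rfl fun i _ => (Set.indicator_of_mem (hx i trivial) _).symm
    · rw [Set.indicator_of_notMem hx]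
      simp only [Set.mem_pi, Set.mem_univ, true_imp_iff, not_forall] at hx
      obtain ⟨i, hi⟩ := hx
      exact (Finset.prod_eq_zero (Finset.mem_univ i) (Set.indicator_of_notMem hi _)).symm
  rw [this, lintegral_pi_prod μ _ hind]
  refine Finset.prod_congr rfl fun i _ => ?_
  rw [lintegral_indicator (hs i), withDensity_apply _ (hs i)]

lemma gaussianReal_one_eq_withDensity (m : ℝ) :
    gaussianReal m 1 = (gaussianReal 0 1).withDensity
      (fun x => ENNReal.ofReal (Real.exp (m * x - m ^ 2 / 2))) := by
  rw [gaussianReal_of_var_ne_zero _ one_ne_zero, gaussianReal_of_var_ne_zero _ one_ne_zero,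
    ← withDensity_mul _ (measurable_gaussianPDF 0 1) (by fun_prop)]
  congr 1
  ext x
  simp only [gaussianPDF, Pi.mul_apply]
  rw [← ENNReal.ofReal_mul (gaussianPDFReal_nonneg _ _ _)]
  congr 1
  rw [gaussianPDFReal, gaussianPDFReal, mul_assoc _ (Real.exp _), ← Real.exp_add]
  congr 2
  simp
  ring

/-- The density of the translate by `v` of the centered Gaussian of covariance `σ ^ 2 • 1` with
respect to that Gaussian. -/
noncomputable def gaussianShiftDensity {E : Type*} [NormedAddCommGroup E] [InnerProductSpace ℝ E]
    (σ : ℝ) (v z : E) : ℝ≥0∞ :=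
  ENNReal.ofReal (Real.exp (inner ℝ v z / σ ^ 2 - ‖v‖ ^ 2 / (2 * σ ^ 2)))

lemma measurable_gaussianShiftDensity {E : Type*} [NormedAddCommGroup E] [InnerProductSpace ℝ E]
    [MeasurableSpace E] [BorelSpace E] [SecondCountableTopology E] {X : Type*} [MeasurableSpace X]
    {σ : ℝ} {f g : X → E} (hf : Measurable f) (hg : Measurable g) :
    Measurable fun x => gaussianShiftDensity σ (f x) (g x) := by
  unfold gaussianShiftDensity
  fun_prop

lemma map_add_stdGaussian {n : ℕ} (v : EuclideanSpace ℝ (Fin n)) :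
    (stdGaussian (EuclideanSpace ℝ (Fin n))).map (fun z => z + v) =
      (stdGaussian (EuclideanSpace ℝ (Fin n))).withDensity (gaussianShiftDensity 1 v) := by
  have hto : Measurable (WithLp.toLp 2 : (Fin n → ℝ) → EuclideanSpace ℝ (Fin n)) := by fun_prop
  have h1 : (stdGaussian (EuclideanSpace ℝ (Fin n))).map (fun z => z + v) =
      (Measure.pi fun i => gaussianReal (v i) 1).map (WithLp.toLp 2) := by
    rw [← map_pi_eq_stdGaussian, Measure.map_map (by fun_prop) hto]
    have : Measure.pi (fun i => gaussianReal (v i) 1) =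
        (Measure.pi fun _ : Fin n => gaussianReal 0 1).map (fun x i => x i + v i) := by
      rw [Measure.pi_map_pi (f := fun i x => x + v i) (fun i => by fun_prop)]
      congr 1
      ext1 i
      rw [gaussianReal_map_add_const, zero_add]
    rw [this, Measure.map_map hto (by fun_prop)]
    rfl
  have hprob : ∀ i, IsProbabilityMeasure ((gaussianReal 0 1).withDensity
      (fun x => ENNReal.ofReal (Real.exp (v i * x - v i ^ 2 / 2)))) := fun i => by
    rw [← gaussianReal_one_eq_withDensity]; infer_instance
  rw [h1, ← map_pi_eq_stdGaussian]
  have h2 : (fun i => gaussianReal (v i) 1) = fun i => (gaussianReal 0 1).withDensity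
      (fun x => ENNReal.ofReal (Real.exp (v i * x - v i ^ 2 / 2))) :=
    funext fun i => gaussianReal_one_eq_withDensity _
  rw [h2, pi_withDensity_eq (fun _ : Fin n => gaussianReal 0 1) _ (fun i => by fun_prop)]
  have hd : Measurable (gaussianShiftDensity 1 v) :=
    measurable_gaussianShiftDensity measurable_const measurable_id
  ext s hs
  rw [Measure.map_apply hto hs, withDensity_apply _ (hto hs), withDensity_apply _ hs,
    setLIntegral_map hs hd hto]
  refine lintegral_congr fun x => ?_
  rw [← ENNReal.ofReal_prod_of_nonneg (fun i _ => (Real.exp_pos _).le), ← Real.exp_sum]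
  unfold gaussianShiftDensity
  congr 2
  rw [EuclideanSpace.real_norm_sq_eq, PiLp.inner_apply, Finset.sum_sub_distrib, Finset.sum_div]
  simp [mul_comm, Finset.sum_div]

lemma multivariateGaussian_smul_one {n : ℕ} {σ : ℝ} (hσ : 0 < σ) :
    multivariateGaussian 0 (σ ^ 2 • (1 : Matrix (Fin n) (Fin n) ℝ)) =
      (stdGaussian (EuclideanSpace ℝ (Fin n))).map (fun z => σ • z) := by
  have hps : (σ ^ 2 • (1 : Matrix (Fin n) (Fin n) ℝ)).PosSemidef :=
    Matrix.PosSemidef.one.smul (by positivity)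
  apply Measure.ext_of_charFun
  ext t
  rw [charFun_multivariateGaussian hps, charFun_map_smul, charFun_stdGaussian]
  congr 1
  have h : t.ofLp ⬝ᵥ (σ ^ 2 • (1 : Matrix (Fin n) (Fin n) ℝ)).mulVec t.ofLp = ‖σ • t‖ ^ 2 := by
    rw [norm_smul, mul_pow, EuclideanSpace.real_norm_sq_eq, Real.norm_eq_abs, sq_abs,
      Matrix.smul_mulVec, Matrix.one_mulVec, dotProduct_smul, smul_eq_mul]
    simp [dotProduct, pow_two]
  rw [h]
  simp [neg_div]

lemma map_add_multivariateGaussian {n : ℕ} {σ : ℝ} (hσ : 0 < σ)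
    (v : EuclideanSpace ℝ (Fin n)) :
    (multivariateGaussian 0 (σ ^ 2 • (1 : Matrix (Fin n) (Fin n) ℝ))).map (fun z => z + v) =
      (multivariateGaussian 0 (σ ^ 2 • (1 : Matrix (Fin n) (Fin n) ℝ))).withDensity
        (gaussianShiftDensity σ v) := by
  have hsm : Measurable fun z : EuclideanSpace ℝ (Fin n) => σ • z := by fun_prop
  rw [multivariateGaussian_smul_one hσ, Measure.map_map (by fun_prop) hsm]
  have h1 : (fun z => z + v) ∘ (fun z : EuclideanSpace ℝ (Fin n) => σ • z) =
      (fun z => σ • z) ∘ fun z => z + σ⁻¹ • v := by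
    ext1 z
    simp [smul_add, smul_smul, hσ.ne']
  rw [h1, ← Measure.map_map hsm (by fun_prop), map_add_stdGaussian]
  have hd : Measurable (gaussianShiftDensity σ v) :=
    measurable_gaussianShiftDensity measurable_const measurable_id
  ext s hs
  rw [Measure.map_apply hsm hs, withDensity_apply _ (hsm hs), withDensity_apply _ hs,
    setLIntegral_map hs hd hsm]
  refine lintegral_congr fun x => ?_
  unfold gaussianShiftDensity
  congr 2
  rw [real_inner_smul_left, real_inner_smul_right, norm_smul, Real.norm_eq_abs, mul_pow, sq_abs]
  field_simp

/-- Completing the square, the `α`-th power of the density for `v` is a constant times the density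
for `α • v`, which has integral one. -/
lemma lintegral_gaussianShiftDensity_rpow {n : ℕ} {σ : ℝ} (hσ : 0 < σ)
    (v : EuclideanSpace ℝ (Fin n)) {α : ℝ} (hα : 0 ≤ α) :
    ∫⁻ z, gaussianShiftDensity σ v z ^ α
        ∂multivariateGaussian 0 (σ ^ 2 • (1 : Matrix (Fin n) (Fin n) ℝ)) =
      ENNReal.ofReal (Real.exp (α * (α - 1) * ‖v‖ ^ 2 / (2 * σ ^ 2))) := by
  have h1 : ∀ z, gaussianShiftDensity σ v z ^ α =
      ENNReal.ofReal (Real.exp (α * (α - 1) * ‖v‖ ^ 2 / (2 * σ ^ 2))) *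
        gaussianShiftDensity σ (α • v) z := fun z => by
    unfold gaussianShiftDensity
    rw [ENNReal.ofReal_rpow_of_nonneg (Real.exp_pos _).le hα, ← Real.exp_mul,
      ← ENNReal.ofReal_mul (Real.exp_pos _).le, ← Real.exp_add]
    congr 2
    rw [real_inner_smul_left, norm_smul, Real.norm_eq_abs, mul_pow, sq_abs]
    field_simp
    ring
  simp_rw [h1]
  rw [lintegral_const_mul _
      (measurable_gaussianShiftDensity (f := fun _ => α • v) (g := fun z => z)
        measurable_const measurable_id),
    ← setLIntegral_univ (gaussianShiftDensity σ (α • v)), ← withDensity_apply _ .univ,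
    ← map_add_multivariateGaussian hσ, Measure.map_apply (by fun_prop) .univ]
  simp

/-! ### Data processing for the Rényi divergence -/

section Renyi

variable {X X' : Type*} [MeasurableSpace X] [MeasurableSpace X']

lemma absolutelyContinuous_map_of_aemeasurable {μ ν : Measure X} (hμν : μ ≪ ν) {f : X → X'}
    (hf : AEMeasurable f ν) : μ.map f ≪ ν.map f := by
  refine Measure.AbsolutelyContinuous.mk fun s hs h => ?_
  rw [Measure.map_apply_of_aemeasurable hf hs] at h
  rw [Measure.map_apply_of_aemeasurable (hf.mono_ac hμν) hs]
  exact hμν h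

/-- Data-processing inequality for the power integral defining the Rényi divergence. -/
lemma lintegral_rnDeriv_map_rpow_le {μ ν : Measure X} [IsFiniteMeasure μ] [IsFiniteMeasure ν]
    (hμν : μ ≪ ν) {f : X → X'} (hf : AEMeasurable f ν) {α : ℝ} (hα : 1 < α) :
    ∫⁻ y, (μ.map f).rnDeriv (ν.map f) y ^ α ∂ν.map f ≤ ∫⁻ x, μ.rnDeriv ν x ^ α ∂ν := by
  have hfμ : AEMeasurable f μ := hf.mono_ac hμν
  have hα0 : 0 < α := by linarith
  have hα1 : 0 < α - 1 := by linarith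
  have hac : μ.map f ≪ ν.map f := absolutelyContinuous_map_of_aemeasurable hμν hf
  set G := ∫⁻ x, μ.rnDeriv ν x ^ α ∂ν
  set h := (μ.map f).rnDeriv (ν.map f)
  have hh : Measurable h := Measure.measurable_rnDeriv _ _
  have hk : ∀ k : ℕ, Measurable fun y => min (h y) (k : ℝ≥0∞) := fun k => hh.min measurable_const
  -- Truncating at `k` makes `I` finite. Transporting the integral to `μ` and back to `ν` and
  -- applying Hölder gives `I ≤ G^(1/α) * I^(1 - 1/α)`, where the last factor may be cancelled if `I
  -- ≠ 0`.
  have hbound : ∀ k : ℕ, ∫⁻ y, min (h y) (k : ℝ≥0∞) ^ α ∂ν.map f ≤ G := fun k => by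
    set I := ∫⁻ y, min (h y) (k : ℝ≥0∞) ^ α ∂ν.map f
    have hI_top : I ≠ ⊤ := by
      refine ne_top_of_le_ne_top ?_ (lintegral_mono fun y =>
        ENNReal.rpow_le_rpow (min_le_right (h y) (k : ℝ≥0∞)) hα0.le)
      rw [lintegral_const]
      exact ENNReal.mul_ne_top (ENNReal.rpow_ne_top_of_nonneg hα0.le (ENNReal.natCast_ne_top k))
        (measure_ne_top _ _)
    have hconj : α.HolderConjugate (α / (α - 1)) := Real.HolderConjugate.conjExponent hα
    have hle : I ≤ G ^ (1 / α) * I ^ (1 / (α / (α - 1))) := by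
      calc I ≤ ∫⁻ y, h y * min (h y) (k : ℝ≥0∞) ^ (α - 1) ∂ν.map f := by
            refine lintegral_mono fun y => ?_
            calc min (h y) (k : ℝ≥0∞) ^ α = min (h y) (k : ℝ≥0∞) ^ (1 + (α - 1)) := by ring_nf
              _ = min (h y) (k : ℝ≥0∞) * min (h y) (k : ℝ≥0∞) ^ (α - 1) := by
                rw [ENNReal.rpow_add_of_nonneg _ _ zero_le_one hα1.le, ENNReal.rpow_one]
              _ ≤ _ := by gcongr; exact min_le_left _ _
        _ = ∫⁻ y, min (h y) (k : ℝ≥0∞) ^ (α - 1) ∂μ.map f :=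
            lintegral_rnDeriv_mul hac ((hk k).pow_const _).aemeasurable
        _ = ∫⁻ x, min (h (f x)) (k : ℝ≥0∞) ^ (α - 1) ∂μ :=
            lintegral_map' ((hk k).pow_const _).aemeasurable hfμ
        _ = ∫⁻ x, μ.rnDeriv ν x * min (h (f x)) (k : ℝ≥0∞) ^ (α - 1) ∂ν :=
            (lintegral_rnDeriv_mul hμν (((hk k).pow_const _).comp_aemeasurable hf)).symm
        _ ≤ G ^ (1 / α) *
            (∫⁻ x, (min (h (f x)) (k : ℝ≥0∞) ^ (α - 1)) ^ (α / (α - 1)) ∂ν) ^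
              (1 / (α / (α - 1))) :=
            ENNReal.lintegral_mul_le_Lp_mul_Lq ν hconj (Measure.measurable_rnDeriv _ _).aemeasurable
              (((hk k).pow_const _).comp_aemeasurable hf)
        _ = G ^ (1 / α) * I ^ (1 / (α / (α - 1))) := by
            simp_rw [← ENNReal.rpow_mul, mul_div_cancel₀ α hα1.ne']
            congr 2
            exact (lintegral_map' ((hk k).pow_const _).aemeasurable hf).symm
    by_cases hI0 : I = 0
    · rw [hI0]; exact zero_le
    have hsplit : I = I ^ (1 / α) * I ^ (1 / (α / (α - 1))) := by
      rw [← ENNReal.rpow_add _ _ hI0 hI_top]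
      have : 1 / α + 1 / (α / (α - 1)) = 1 := by field_simp; ring
      rw [this, ENNReal.rpow_one]
    have hpos : I ^ (1 / (α / (α - 1))) ≠ 0 := by
      simp [ENNReal.rpow_eq_zero_iff, hI0, hI_top]
    have hfin : I ^ (1 / (α / (α - 1))) ≠ ⊤ :=
      ENNReal.rpow_ne_top_of_nonneg (by positivity) hI_top
    have h2 : I ^ (1 / α) ≤ G ^ (1 / α) := by
      rw [← ENNReal.mul_le_mul_iff_left hpos hfin, ← hsplit]
      exact hle
    exact (ENNReal.rpow_le_rpow_iff (by positivity)).1 h2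
  have hlim := lintegral_tendsto_of_tendsto_of_monotone (μ := ν.map f)
    (f := fun (k : ℕ) y => min (h y) (k : ℝ≥0∞) ^ α) (F := fun y => h y ^ α)
    (fun k => ((hk k).pow_const _).aemeasurable)
    (Filter.Eventually.of_forall fun y k l hkl => by dsimp only; gcongr)
    (Filter.Eventually.of_forall fun y => by
      have h1 : Filter.Tendsto (fun k : ℕ => min (h y) (k : ℝ≥0∞)) Filter.atTop
          (nhds (min (h y) ⊤)) :=
        tendsto_const_nhds.min ENNReal.tendsto_nat_nhds_top
      rw [min_top_right] at h1
      exact (ENNReal.continuous_rpow_const.tendsto _).comp h1)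
  exact le_of_tendsto' hlim hbound

lemma renyiDiv_le_add_of_lintegral_le {α c : ℝ} (hα : 1 < α) {μ ν : Measure X} {μ' ν' : Measure X'}
    (hμ : μ ≪ ν) (hμ' : μ' ≪ ν')
    (h : ∫⁻ x, μ'.rnDeriv ν' x ^ α ∂ν' ≤
      ENNReal.ofReal (Real.exp ((α - 1) * c)) * ∫⁻ x, μ.rnDeriv ν x ^ α ∂ν) :
    renyiDiv α μ' ν' ≤ renyiDiv α μ ν + (c : EReal) := by
  have hα1 : 0 < α - 1 := by linarith
  have hpos : (0 : EReal) ≤ (((α - 1)⁻¹ : ℝ) : EReal) := by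
    exact_mod_cast (inv_pos.2 hα1).le
  unfold renyiDiv
  rw [if_pos hμ', if_pos hμ]
  refine (mul_le_mul_of_nonneg_left (ENNReal.log_le_log h) hpos).trans_eq ?_
  rw [ENNReal.log_mul_add, ENNReal.log_ofReal_of_pos (Real.exp_pos _), Real.log_exp,
    EReal.left_distrib_of_nonneg_of_ne_top hpos (EReal.coe_ne_top _), add_comm,
    ← EReal.coe_mul, inv_mul_cancel_left₀ hα1.ne']

end Renyi

/-! ### Couplings and displacement -/

section Coupling

/-- A measure whose first marginal is absolutely continuous with respect to `ν` has a density,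
depending only on the first coordinate, with respect to a measure with first marginal `ν`. -/
lemma exists_fst_eq_and_eq_withDensity {X X' : Type*} [MeasurableSpace X] [MeasurableSpace X']
    [StandardBorelSpace X'] [Nonempty X'] (π : Measure (X × X')) [IsFiniteMeasure π]
    (ν : Measure X) [IsProbabilityMeasure ν] (h : π.fst ≪ ν) :
    ∃ ρ : Measure (X × X'), IsProbabilityMeasure ρ ∧ ρ.fst = ν ∧
      π = ρ.withDensity fun p => π.fst.rnDeriv ν p.1 := by
  -- Keep the conditional law of the second coordinate given the first, and replace only the first
  -- marginal by `ν`.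
  refine ⟨ν ⊗ₘ π.condKernel, inferInstance, Measure.fst_compProd _ _, ?_⟩
  have hr : Measurable (π.fst.rnDeriv ν) := Measure.measurable_rnDeriv _ _
  ext s hs
  have hsm : Measurable (s.indicator fun p => π.fst.rnDeriv ν p.1) :=
    (hr.comp measurable_fst).indicator hs
  rw [withDensity_apply _ hs, ← lintegral_indicator hs, Measure.lintegral_compProd hsm]
  conv_lhs => rw [← π.disintegrate π.condKernel, Measure.compProd_apply hs,
    ← lintegral_rnDeriv_mul h (Kernel.measurable_kernel_prodMk_left hs).aemeasurable]
  refine lintegral_congr fun x => ?_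
  have : ∀ y, s.indicator (fun p : X × X' => π.fst.rnDeriv ν p.1) (x, y) =
      (Prod.mk x ⁻¹' s).indicator (fun _ => π.fst.rnDeriv ν x) y := fun y => by
    by_cases hy : (x, y) ∈ s <;> simp [hy]
  simp_rw [this]
  rw [lintegral_indicator (measurable_prodMk_left hs), setLIntegral_const]

lemma wassersteinInfty_map_le {X E : Type*} [MeasurableSpace X] [NormedAddCommGroup E]
    [MeasurableSpace E] [BorelSpace E] [SecondCountableTopology E] {ρ : Measure X} {f g : X → E}
    (hf : Measurable f) (hg : Measurable g) {r : ℝ} (h : ∀ᵐ x ∂ρ, ‖f x - g x‖ ≤ r) :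
    wassersteinInfty (ρ.map f) (ρ.map g) ≤ ENNReal.ofReal r := by
  refine iInf₂_le_of_le (ρ.map fun x => (f x, g x)) ⟨?_, ?_⟩ ?_
  · rw [Measure.map_map measurable_fst (hf.prodMk hg)]; rfl
  · rw [Measure.map_map measurable_snd (hf.prodMk hg)]; rfl
  · refine essSup_le_of_ae_le _ ?_
    have hm : MeasurableSet {p : E × E | ‖p.1 - p.2‖ₑ ≤ ENNReal.ofReal r} :=
      measurableSet_le (by fun_prop) measurable_const
    refine (ae_map_iff (hf.prodMk hg).aemeasurable hm).2 ?_
    filter_upwards [h] with x hx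
    rw [← ofReal_norm]
    exact ENNReal.ofReal_le_ofReal hx

lemma exists_coupling_of_wassersteinInfty_lt {E : Type*} [NormedAddCommGroup E]
    [MeasurableSpace E] {μ ν : Measure E} {r : ℝ} (hr : 0 ≤ r)
    (h : wassersteinInfty μ ν < ENNReal.ofReal r) :
    ∃ π, IsCouplingOf π μ ν ∧ ∀ᵐ p ∂π, ‖p.1 - p.2‖ ≤ r := by
  obtain ⟨π, h1⟩ := iInf_lt_iff.1 h
  obtain ⟨hπ, h2⟩ := iInf_lt_iff.1 h1
  refine ⟨π, hπ, ?_⟩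
  filter_upwards [ae_lt_of_essSup_lt h2] with p hp
  rw [← ofReal_norm] at hp
  exact (ENNReal.ofReal_le_ofReal_iff hr).1 hp.le

/-- A vector `d` with `‖d‖ ≤ R` splits into `(a / R) • d` and a remainder of norm at most
`R - a`. -/
lemma norm_div_smul_le {E : Type*} [NormedAddCommGroup E] [NormedSpace ℝ E] {d : E} {a R : ℝ}
    (ha : 0 ≤ a) (haR : a ≤ R) (hd : ‖d‖ ≤ R) :
    ‖(a / R) • d‖ ≤ a ∧ ‖d - (a / R) • d‖ ≤ R - a := by
  rcases (ha.trans haR).eq_or_lt with h | hR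
  -- If `R = 0` then `d = 0`, so the default value of `a / 0` is harmless.
  · have : ‖d‖ ≤ 0 := hd.trans h.ge
    rw [norm_le_zero_iff] at this
    subst this
    simpa using ⟨ha, haR⟩
  · have h1 : a / R ≤ 1 := (div_le_one hR).2 haR
    have h2 : d - (a / R) • d = (1 - a / R) • d := by module
    rw [h2, norm_smul, norm_smul, Real.norm_of_nonneg (by positivity),
      Real.norm_of_nonneg (by linarith)]
    constructor
    · calc a / R * ‖d‖ ≤ a / R * R := by gcongr
        _ = a := div_mul_cancel₀ a hR.ne'
    · calc (1 - a / R) * ‖d‖ ≤ (1 - a / R) * R := by gcongr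
        _ = R - a := by field_simp

end Coupling

/-! ### Joint density after a translation of the noise -/

section GaussianShift

variable {n : ℕ} {X : Type*} [MeasurableSpace X]

local notation "E" => EuclideanSpace ℝ (Fin n)

/-- For fixed `x` the noise is translated by the constant `v x`, so Cameron–Martin applies
fibrewise. -/
lemma map_shift_withDensity_prod_multivariateGaussian {σ : ℝ} (hσ : 0 < σ) (ρ : Measure X)
    [IsFiniteMeasure ρ] {q : X → ℝ≥0∞} (hq : Measurable q) [IsFiniteMeasure (ρ.withDensity q)]
    {v : X → E} (hv : Measurable v) :
    ((ρ.withDensity q).prod (multivariateGaussian (0 : E) (σ ^ 2 • 1))).map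
        (fun p => (p.1, p.2 + v p.1)) =
      (ρ.prod (multivariateGaussian (0 : E) (σ ^ 2 • 1))).withDensity
        (fun p => q p.1 * gaussianShiftDensity σ (v p.1) p.2) := by
  set N := multivariateGaussian (0 : E) (σ ^ 2 • 1)
  have hsh : Measurable fun p : X × E => (p.1, p.2 + v p.1) := by fun_prop
  have hg : Measurable fun p : X × E => gaussianShiftDensity σ (v p.1) p.2 :=
    measurable_gaussianShiftDensity (hv.comp measurable_fst) measurable_snd
  ext s hs
  have hind : Measurable (s.indicator (1 : X × E → ℝ≥0∞)) := measurable_one.indicator hs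
  have hindsh : Measurable fun p : X × E => s.indicator (1 : X × E → ℝ≥0∞) (p.1, p.2 + v p.1) :=
    hind.comp hsh
  have hqg : Measurable fun p : X × E => q p.1 * gaussianShiftDensity σ (v p.1) p.2 :=
    (hq.comp measurable_fst).mul hg
  rw [← lintegral_indicator_one hs, lintegral_map hind hsh,
    lintegral_prod _ hindsh.aemeasurable,
    lintegral_withDensity_eq_lintegral_mul _ hq hindsh.lintegral_prod_right',
    withDensity_apply _ hs, ← lintegral_indicator hs,
    lintegral_prod _ (hqg.indicator hs).aemeasurable]
  refine lintegral_congr fun x => ?_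
  have hindx : Measurable fun z => s.indicator (1 : X × E → ℝ≥0∞) (x, z) :=
    hind.comp measurable_prodMk_left
  have hgx : Measurable (gaussianShiftDensity σ (v x)) :=
    measurable_gaussianShiftDensity (f := fun _ => v x) (g := fun z => z)
      measurable_const measurable_id
  have h1 : ∫⁻ z, s.indicator (1 : X × E → ℝ≥0∞) (x, z + v x) ∂N =
      ∫⁻ z, gaussianShiftDensity σ (v x) z * s.indicator (1 : X × E → ℝ≥0∞) (x, z) ∂N := by
    rw [← lintegral_map (g := fun z => z + v x) hindx (by fun_prop),
      map_add_multivariateGaussian hσ, lintegral_withDensity_eq_lintegral_mul _ hgx hindx]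
    rfl
  have hgi : Measurable fun z =>
      gaussianShiftDensity σ (v x) z * s.indicator (1 : X × E → ℝ≥0∞) (x, z) := hgx.mul hindx
  simp only [Pi.mul_apply]
  rw [h1, ← lintegral_const_mul _ hgi]
  refine lintegral_congr fun z => ?_
  by_cases hz : (x, z) ∈ s <;> simp [hz]

lemma lintegral_mul_gaussianShiftDensity_rpow_le {σ : ℝ} (hσ : 0 < σ) (ρ : Measure X)
    [IsFiniteMeasure ρ] {q : X → ℝ≥0∞} (hq : Measurable q) {v : X → E} (hv : Measurable v)
    {a α : ℝ} (hα : 1 ≤ α) (hva : ∀ᵐ x ∂ρ.withDensity q, ‖v x‖ ≤ a) :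
    ∫⁻ p, (q p.1 * gaussianShiftDensity σ (v p.1) p.2) ^ α
        ∂ρ.prod (multivariateGaussian (0 : E) (σ ^ 2 • 1)) ≤
      ENNReal.ofReal (Real.exp ((α - 1) * (α * a ^ 2 / (2 * σ ^ 2)))) * ∫⁻ x, q x ^ α ∂ρ := by
  have hα0 : 0 < α := by linarith
  have hg : Measurable fun p : X × E => gaussianShiftDensity σ (v p.1) p.2 :=
    measurable_gaussianShiftDensity (hv.comp measurable_fst) measurable_snd
  have hqg : Measurable fun p : X × E => (q p.1 * gaussianShiftDensity σ (v p.1) p.2) ^ α :=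
    ((hq.comp measurable_fst).mul hg).pow_const α
  rw [lintegral_prod _ hqg.aemeasurable,
    ← lintegral_const_mul _ (hq.pow_const α)]
  refine lintegral_mono_ae ?_
  filter_upwards [(ae_withDensity_iff hq).1 hva] with x hx
  have hgx : Measurable (gaussianShiftDensity σ (v x)) :=
    measurable_gaussianShiftDensity (f := fun _ => v x) (g := fun z => z)
      measurable_const measurable_id
  simp_rw [ENNReal.mul_rpow_of_nonneg _ _ hα0.le]
  rw [lintegral_const_mul _ (hgx.pow_const α), lintegral_gaussianShiftDensity_rpow hσ _ hα0.le,
    mul_comm]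
  -- The bound on `v x` is known only where `q x ≠ 0`; elsewhere both sides vanish.
  by_cases hq0 : q x = 0
  · simp [hq0, hα0]
  have := hx hq0
  have h1 : 0 ≤ α - 1 := by linarith
  have h2 : ‖v x‖ ^ 2 ≤ a ^ 2 := pow_le_pow_left₀ (norm_nonneg _) this 2
  gcongr
  rw [← mul_div_assoc]
  gcongr ?_ / _
  nlinarith [mul_nonneg hα0.le h1]

end GaussianShift

/-! ### Shift reduction along a coupling -/

section ShiftReduction

lemma prod_map_left_eq {X Y F : Type*} [MeasurableSpace X] [MeasurableSpace Y] [MeasurableSpace F]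
    (ρ : Measure X) [IsFiniteMeasure ρ] (N : Measure F) [IsFiniteMeasure N] {f : X → Y}
    (hf : Measurable f) :
    (ρ.map f).prod N = (ρ.prod N).map (Prod.map f id) := by
  rw [← Measure.map_prod_map _ _ hf measurable_id, Measure.map_id]

variable {n : ℕ}

local notation "E" => EuclideanSpace ℝ (Fin n)

/-- Shift reduction along a coupling: adding Gaussian noise absorbs `a` of the displacement `R`. -/
lemma shiftedRenyiDiv_map_prod_multivariateGaussian_le {σ : ℝ} (hσ : 0 < σ) {μ ν γ : Measure E}
    [IsProbabilityMeasure μ] [IsProbabilityMeasure ν] [IsProbabilityMeasure γ] (hγν : γ ≪ ν)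
    {π : Measure (E × E)} (hπ : IsCouplingOf π μ γ) {φ φ' θ : E → E} (hφ : Measurable φ)
    (hφ' : Measurable φ') (hθ : LipschitzWith 1 θ) {a R α : ℝ} (ha : 0 ≤ a) (haR : a ≤ R)
    (hα : 1 < α) (hR : ∀ᵐ p ∂π, ‖φ p.1 - φ' p.2‖ ≤ R) :
    shiftedRenyiDiv α (R - a)
        ((μ.prod (multivariateGaussian (0 : E) (σ ^ 2 • 1))).map fun p => θ (φ p.1 + p.2))
        ((ν.prod (multivariateGaussian (0 : E) (σ ^ 2 • 1))).map fun p => θ (φ' p.1 + p.2))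
      ≤ renyiDiv α γ ν + ((α * a ^ 2 / (2 * σ ^ 2) : ℝ) : EReal) := by
  set N := multivariateGaussian (0 : E) (σ ^ 2 • 1)
  have hθm : Measurable θ := hθ.continuous.measurable
  obtain ⟨hπ1, hπ2⟩ := hπ
  -- The coupling is swapped because disintegration is over the first coordinate, where `γ` must be
  -- compared with `ν`.
  have hfst : (π.map Prod.swap).fst = γ := by rw [Measure.fst_map_swap]; exact hπ2
  have hsnd : (π.map Prod.swap).snd = μ := by rw [Measure.snd_map_swap]; exact hπ1
  have hRs : ∀ᵐ p ∂π.map Prod.swap, ‖φ p.2 - φ' p.1‖ ≤ R := by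
    have hm : MeasurableSet {p : E × E | ‖φ p.2 - φ' p.1‖ ≤ R} :=
      measurableSet_le (by fun_prop) measurable_const
    exact (ae_map_iff measurable_swap.aemeasurable hm).2 hR
  set π' := π.map Prod.swap
  have hπ'p : IsProbabilityMeasure π' := ⟨by
    rw [← Measure.fst_univ, hfst]; exact measure_univ⟩
  obtain ⟨ρ, hρp, hρ1, hρ⟩ := exists_fst_eq_and_eq_withDensity π' ν (hfst ▸ hγν)
  rw [hfst] at hρ
  set q : E × E → ℝ≥0∞ := fun p => γ.rnDeriv ν p.1
  have hr : Measurable (γ.rnDeriv ν) := Measure.measurable_rnDeriv _ _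
  have hq : Measurable q := hr.comp measurable_fst
  have hqp : IsProbabilityMeasure (ρ.withDensity q) := hρ ▸ hπ'p
  set v : E × E → E := fun p => (a / R) • (φ p.2 - φ' p.1)
  have hv : Measurable v := by fun_prop
  have hva : ∀ᵐ p ∂π', ‖v p‖ ≤ a := hRs.mono fun p hp => (norm_div_smul_le ha haR hp).1
  have hshift := map_shift_withDensity_prod_multivariateGaussian hσ ρ hq hv
  rw [← hρ] at hshift
  set sh : (E × E) × E → (E × E) × E := fun p => (p.1, p.2 + v p.1)
  have hsh : Measurable sh := by fun_prop
  set T : (E × E) × E → E := fun p => θ (φ' p.1.1 + p.2)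
  have hT : Measurable T := by fun_prop
  set D : (E × E) × E → ℝ≥0∞ := fun p => q p.1 * gaussianShiftDensity σ (v p.1) p.2
  have hD : Measurable D := (hq.comp measurable_fst).mul
    (measurable_gaussianShiftDensity (hv.comp measurable_fst) measurable_snd)
  have hlaw : (μ.prod N).map (fun p => θ (φ p.1 + p.2)) =
      (π'.prod N).map fun p => θ (φ p.1.2 + p.2) := by
    rw [← hsnd, Measure.snd, prod_map_left_eq π' N measurable_snd,
      Measure.map_map (by fun_prop) (by fun_prop)]
    rfl
  have hlaw' : (ν.prod N).map (fun p => θ (φ' p.1 + p.2)) = (ρ.prod N).map T := by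
    rw [← hρ1, Measure.fst, prod_map_left_eq ρ N measurable_fst,
      Measure.map_map (by fun_prop) (by fun_prop)]
    rfl
  have hprob : IsProbabilityMeasure ((π'.prod N).map sh) :=
    Measure.isProbabilityMeasure_map hsh.aemeasurable
  have hW : wassersteinInfty ((π'.prod N).map fun p => θ (φ p.1.2 + p.2))
      (((π'.prod N).map sh).map T) ≤ ENNReal.ofReal (R - a) := by
    rw [Measure.map_map hT hsh]
    refine wassersteinInfty_map_le (by fun_prop) (hT.comp hsh) ?_
    have hm : MeasurableSet {p : E × E | ‖φ p.2 - φ' p.1‖ ≤ R} :=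
      measurableSet_le (by fun_prop) measurable_const
    have hRN : ∀ᵐ p ∂π'.prod N, ‖φ p.1.2 - φ' p.1.1‖ ≤ R :=
      Measure.quasiMeasurePreserving_fst.ae hRs
    filter_upwards [hRN] with p hp
    refine (hθ.norm_sub_le _ _).trans ?_
    rw [NNReal.coe_one, one_mul]
    refine le_of_eq_of_le ?_ (norm_div_smul_le ha haR hp).2
    congr 1
    simp only [sh, v]
    abel
  rw [hlaw, hlaw']
  -- The competitor is the law of `θ (φ' y + z + v)`; it and the reference law are images under the
  -- same map `T`, so data processing applies.
  refine (iInf₂_le_of_le (((π'.prod N).map sh).map T)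
    (Measure.isProbabilityMeasure_map hT.aemeasurable) (iInf_le _ hW)).trans ?_
  have hac : (π'.prod N).map sh ≪ ρ.prod N := hshift ▸ withDensity_absolutelyContinuous _ _
  refine renyiDiv_le_add_of_lintegral_le hα hγν
    (absolutelyContinuous_map_of_aemeasurable hac hT.aemeasurable) ?_
  calc ∫⁻ y, (((π'.prod N).map sh).map T).rnDeriv ((ρ.prod N).map T) y ^ α ∂(ρ.prod N).map T
      ≤ ∫⁻ p, ((π'.prod N).map sh).rnDeriv (ρ.prod N) p ^ α ∂ρ.prod N :=
        lintegral_rnDeriv_map_rpow_le hac hT.aemeasurable hα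
    _ = ∫⁻ p, D p ^ α ∂ρ.prod N := by
        rw [hshift]
        refine lintegral_congr_ae ?_
        filter_upwards [Measure.rnDeriv_withDensity (ρ.prod N) hD] with p hp
        rw [hp]
    _ ≤ ENNReal.ofReal (Real.exp ((α - 1) * (α * a ^ 2 / (2 * σ ^ 2)))) * ∫⁻ x, q x ^ α ∂ρ :=
        lintegral_mul_gaussianShiftDensity_rpow_le hσ ρ hq hv hα.le (hρ ▸ hva)
    _ = _ := by
        congr 1
        rw [← lintegral_map (g := Prod.fst) (hr.pow_const α) measurable_fst]
        exact congrArg (fun m => ∫⁻ x, γ.rnDeriv ν x ^ α ∂m) hρ1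

end ShiftReduction

/-! ### Passage to random variables and to the limit in the slack -/

lemma EReal.le_add_coe_of_forall_pos {x D : EReal} {c : ℝ → ℝ} (hc : Continuous c)
    (h : ∀ ε, 0 < ε → x ≤ D + (c ε : EReal)) : x ≤ D + (c 0 : EReal) := by
  have h1 : Filter.Tendsto (fun ε => (D, (c ε : EReal))) (nhdsWithin 0 (Set.Ioi 0))
      (nhds (D, (c 0 : EReal))) :=
    tendsto_const_nhds.prodMk_nhds
      (((continuous_coe_real_ereal.comp hc).tendsto 0).mono_left nhdsWithin_le_nhds)
  have h2 := (EReal.continuousAt_add (p := (D, (c 0 : EReal))) (Or.inr (EReal.coe_ne_bot _))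
    (Or.inr (EReal.coe_ne_top _))).tendsto.comp h1
  refine ge_of_tendsto h2 ?_
  filter_upwards [self_mem_nhdsWithin] with ε hε
  exact h ε hε

/-- Independence turns the joint law into a product, and the measurable representative of `φ`
changes nothing almost surely. -/
lemma map_indepFun_add_eq {Ω F G : Type*} [MeasurableSpace Ω] [NormedAddCommGroup F]
    [MeasurableSpace F] [BorelSpace F] [SecondCountableTopology F] [MeasurableSpace G]
    {P : Measure Ω} [IsProbabilityMeasure P] {Y : Ω → G} {Z : Ω → F} {N : Measure F}
    (hY : AEMeasurable Y P) (hZ : HasLaw Z N P) (hYZ : IndepFun Y Z P) {φ : G → F}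
    (hφ : AEMeasurable φ (P.map Y)) {θ : F → F} (hθ : Measurable θ) :
    P.map (fun ω => θ (φ (Y ω) + Z ω)) =
      ((P.map Y).prod N).map fun p => θ (hφ.mk φ p.1 + p.2) := by
  have hm : Measurable fun p : G × F => θ (hφ.mk φ p.1 + p.2) :=
    hθ.comp ((hφ.measurable_mk.comp measurable_fst).add measurable_snd)
  have h1 : (fun ω => θ (φ (Y ω) + Z ω)) =ᵐ[P] fun ω => θ (hφ.mk φ (Y ω) + Z ω) := by
    filter_upwards [ae_of_ae_map hY hφ.ae_eq_mk] with ω hω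
    rw [hω]
  rw [Measure.map_congr h1, ← hZ.map_eq,
    ← (indepFun_iff_map_prod_eq_prod_map_map hY hZ.aemeasurable).1 hYZ,
    AEMeasurable.map_map_of_aemeasurable hm.aemeasurable (hY.prodMk hZ.aemeasurable)]
  rfl

theorem lemma2p1 {n : ℕ} {Ω : Type*} [MeasurableSpace Ω] (P : Measure Ω) [IsProbabilityMeasure P]
    (φ φ' : EuclideanSpace ℝ (Fin n) → EuclideanSpace ℝ (Fin n))
    (domφ domφ' : Set (EuclideanSpace ℝ (Fin n)))
    (L ζ s : ℝ) (hL : 0 ≤ L) (hζ : 0 ≤ ζ)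
    (hs : ∀ u ∈ domφ ∩ domφ', ‖φ' u - φ u‖ ≤ s)
    (hφ : ∀ x ∈ domφ ∩ domφ', ∀ y ∈ domφ ∩ domφ', ‖φ x - φ y‖ ≤ L * ‖x - y‖ + ζ)
    (hφ' : ∀ x ∈ domφ ∩ domφ', ∀ y ∈ domφ ∩ domφ', ‖φ' x - φ' y‖ ≤ L * ‖x - y‖ + ζ)
    (Y Y' Z : Ω → EuclideanSpace ℝ (Fin n))
    (hY : AEMeasurable Y P) (hY' : AEMeasurable Y' P)
    (hYdom : ∀ᵐ x ∂(P.map Y), x ∈ domφ ∩ domφ')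
    (hY'dom : ∀ᵐ x ∂(P.map Y'), x ∈ domφ ∩ domφ')
    (hφm : AEMeasurable φ (P.map Y)) (hφ'm : AEMeasurable φ' (P.map Y'))
    (σ : ℝ) (hσ : 0 < σ)
    (hZ : HasLaw Z (multivariateGaussian 0 (σ ^ 2 • (1 : Matrix (Fin n) (Fin n) ℝ))) P)
    (hYZ : IndepFun Y Z P) (hY'Z : IndepFun Y' Z P)
    (ψ : EuclideanSpace ℝ (Fin n) → EReal) (hψ : IsProperLscConvex ψ)
    (a τ α : ℝ) (ha : 0 ≤ a) (hτ : 0 ≤ τ) (hα : 1 < α) (hshift : 0 ≤ L * τ + ζ + s - a) :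
    shiftedRenyiDiv α (L * τ + ζ + s - a)
        (P.map fun ω => prox ψ (φ (Y ω) + Z ω)) (P.map fun ω => prox ψ (φ' (Y' ω) + Z ω))
      ≤ shiftedRenyiDiv α τ (P.map Y) (P.map Y')
        + ((α * a ^ 2 / (2 * σ ^ 2) : ℝ) : EReal) := by

  have hμp : IsProbabilityMeasure (P.map Y) := Measure.isProbabilityMeasure_map hY
  have hνp : IsProbabilityMeasure (P.map Y') := Measure.isProbabilityMeasure_map hY'
  have hprox := hψ.lipschitzWith_prox
  -- The finite constant is moved across so that the infimum over `γ` stands alone on the right,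
  -- then moved back for each `γ`.
  refine (EReal.sub_le_iff_le_add (Or.inl (EReal.coe_ne_bot _)) (Or.inl (EReal.coe_ne_top _))).1 ?_
  refine le_iInf₂ fun γ hγ => le_iInf fun hW => ?_
  refine (EReal.sub_le_iff_le_add (Or.inl (EReal.coe_ne_bot _)) (Or.inl (EReal.coe_ne_top _))).2 ?_
  by_cases hγν : γ ≪ P.map Y'
  swap
  · rw [renyiDiv, if_neg hγν, EReal.top_add_coe]
    exact le_top
  rw [map_indepFun_add_eq hY hZ hYZ hφm hprox.continuous.measurable,
    map_indepFun_add_eq hY' hZ hY'Z hφ'm hprox.continuous.measurable]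
  -- `W_∞` need not be attained a priori, so a slack `ε` is absorbed into the noise.
  refine (EReal.le_add_coe_of_forall_pos (c := fun ε => α * (a + L * ε) ^ 2 / (2 * σ ^ 2))
    (D := renyiDiv α γ (P.map Y')) (by fun_prop) fun ε hε => ?_).trans_eq (by simp)
  obtain ⟨π, hπ, hπτ⟩ := exists_coupling_of_wassersteinInfty_lt (r := τ + ε) (by linarith)
    (hW.trans_lt ((ENNReal.ofReal_lt_ofReal_iff (by linarith)).2 (by linarith)))
  have h1 : ∀ᵐ p ∂π, p.1 ∈ domφ ∩ domφ' ∧ φ p.1 = hφm.mk φ p.1 := by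
    rw [← hπ.1] at hYdom
    have h := hφm.ae_eq_mk
    nth_rw 1 [← hπ.1] at h
    exact (ae_of_ae_map measurable_fst.aemeasurable hYdom).and
      (ae_of_ae_map measurable_fst.aemeasurable h)
  have h2 : ∀ᵐ p ∂π, p.2 ∈ domφ ∩ domφ' ∧ φ' p.2 = hφ'm.mk φ' p.2 := by
    -- Almost sure properties of `Y'` pass to the second coordinate, whose law is `γ`, because `γ ≪
    -- P.map Y'`.
    have h := hγν.ae_le (hY'dom.and hφ'm.ae_eq_mk)
    rw [← hπ.2] at h
    exact ae_of_ae_map measurable_snd.aemeasurable h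
  have hR : ∀ᵐ p ∂π, ‖hφm.mk φ p.1 - hφ'm.mk φ' p.2‖ ≤ L * (τ + ε) + ζ + s := by
    filter_upwards [hπτ, h1, h2] with p hp hp1 hp2
    rw [← hp1.2, ← hp2.2]
    calc ‖φ p.1 - φ' p.2‖ ≤ ‖φ p.1 - φ p.2‖ + ‖φ p.2 - φ' p.2‖ :=
          norm_sub_le_norm_sub_add_norm_sub _ _ _
      _ ≤ (L * ‖p.1 - p.2‖ + ζ) + s := by
        rw [norm_sub_rev (φ p.2)]
        exact add_le_add (hφ _ hp1.1 _ hp2.1) (hs _ hp2.1)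
      _ ≤ L * (τ + ε) + ζ + s := by gcongr
  have hLε : 0 ≤ L * ε := by positivity
  -- Raising `a` by `L * ε` offsets the same increase in `R`, so the remaining shift does not depend
  -- on `ε`.
  have h := shiftedRenyiDiv_map_prod_multivariateGaussian_le hσ hγν hπ hφm.measurable_mk
    hφ'm.measurable_mk hprox (a := a + L * ε) (by linarith) (by linarith) hα hR
  rwa [show L * (τ + ε) + ζ + s - (a + L * ε) = L * τ + ζ + s - a by ring] at h
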